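/- Throughout, graphs are finite and simple. For a graph $G$ with adjacency matrix $A$ let $H(t)=\exp(-itA)$, $t\in\mathbb R$, be its transition matrix, and let $\mathbf e_u$ be the characteristic vector of the vertex $u$. $G$ admits pretty good state transfer (PGST) with respect to a real sequence $(t_m)$ if there are two distinct vertices $u\neq v$ and $\gamma\in\mathbb C$ with $|\gamma|=1$ such that $\lim_{m\to\infty}H(t_m)\mathbf e_u=\gamma\mathbf e_v$. $G$ is almost periodic with respect to $(t_m)$ if $\lim_{m\to\infty}H(t_m)=\gamma I$ for some $\gamma\in\mathbb C$ with $|\gamma|=1$. $G$ is integral if all eigenvalues of $A$ are integers. For $S\subseteq\mathbb Z_n\setminus\{0\}$ with $-S=S$, $\mathrm{Cay}(\mathbb Z_n,S)$ is the graph on $\mathbb Z_n$ in which $a,b$ are adjacent if and only if $a-b\in S$. For $d\mid n$ put $S_n(d)=\{x\in\mathbb Z_n:\gcd(x,n)=d\}$, and for a set $D$ of proper divisors of $n$ (divisors $d<n$, with $d=1$ allowed if $n>1$) put $S_n(D)=\bigcup_{d\in D}S_n(d)$. **Corollary.** Let $n=2^k$ with $k$ a natural number, and let $S\subseteq\mathbb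 Z_n\setminus\{0\}$ with $-S=S$ be such that $\mathrm{Cay}(\mathbb Z_n,S)$ is not integral. Let $d$ be the least divisor of $n$ such that $S\cap S_n(d)$ is a non-empty proper subset of $S_n(d)$. Let $q\ge 1$ be an odd integer, $N=nq$, and $qS=\{qs: s\in S\}\subseteq\mathbb Z_N$ (well defined, since $s$ is determined modulo $n$ and $N=nq$). Let $D$ be any set of proper divisors of $N$ with $qS\cap S_N(D)=\emptyset$. 1. If $|S\cap S_n(d)|\equiv 2\pmod 4$, then $\mathrm{Cay}(\mathbb Z_N,qS\cup S_N(D))$ admits PGST with respect to a sequence in $2\pi\mathbb Z$. 2. If $|S\cap S_n(d)|\equiv 0\pmod 4$, then $\mathrm{Cay}(\mathbb Z_N,qS\cup S_N(D))$ is almost periodic with respect to a sequence in $2\pi\mathbb Z$ that tends to $+\infty$. -/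

import Mathlib

open Filter Topology

namespace CirculantPGST

noncomputable section

/-- The adjacency matrix of `G` with complex entries. -/
def adj {V : Type*} (G : SimpleGraph V) : Matrix V V ℂ :=
  open Classical in G.adjMatrix ℂ

/-- The transition matrix `H(t) = exp (-i t A)` of the graph `G` with adjacency matrix `A`. -/
def transitionMatrix {V : Type*} [Fintype V] [DecidableEq V] (G : SimpleGraph V) (t : ℝ) :
    Matrix V V ℂ :=
  NormedSpace.exp ((-(Complex.I * (t : ℂ))) • adj G)

/-- `G` admits pretty good state transfer, between some pair of distinct vertices `u`, `v`,
with respect to the sequence of times `t`. -/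
def AdmitsPGST {V : Type*} [Fintype V] [DecidableEq V] (G : SimpleGraph V) (t : ℕ → ℝ) : Prop :=
  ∃ u v : V, u ≠ v ∧ ∃ γ : ℂ, ‖γ‖ = 1 ∧
    Tendsto (fun k => (transitionMatrix G (t k)).mulVec (Pi.single u 1)) atTop
      (𝓝 (γ • (Pi.single v 1 : V → ℂ)))

/-- `G` is almost periodic with respect to the sequence of times `t`. -/
def AlmostPeriodic {V : Type*} [Fintype V] [DecidableEq V] (G : SimpleGraph V) (t : ℕ → ℝ) :
    Prop :=
  ∃ γ : ℂ, ‖γ‖ = 1 ∧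
    Tendsto (fun k => transitionMatrix G (t k)) atTop (𝓝 (γ • (1 : Matrix V V ℂ)))

/-- All eigenvalues of the adjacency matrix of `G` are integers. -/
def IsIntegral {V : Type*} [Fintype V] [DecidableEq V] (G : SimpleGraph V) : Prop :=
  ∀ μ : ℂ, Module.End.HasEigenvalue (Matrix.toLin' (adj G)) μ → ∃ z : ℤ, μ = (z : ℂ)

/-- `S` can serve as the connection set of a simple Cayley graph: it is symmetric and omits `0`.
The Cayley graph itself is `SimpleGraph.circulantGraph S`. -/
def IsConnectionSet {Γ : Type*} [AddGroup Γ] (S : Set Γ) : Prop :=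
  (0 : Γ) ∉ S ∧ ∀ s ∈ S, -s ∈ S

/-- `S_n(d) = {x ∈ ℤ_n : gcd(x, n) = d}`. -/
def gcdClass (n d : ℕ) : Set (ZMod n) :=
  {x | Nat.gcd x.val n = d}

/-- The gcd-set `S_n(D)`, the union of the `S_n(d)` over `d ∈ D`. -/
def gcdSet (n : ℕ) (D : Set ℕ) : Set (ZMod n) :=
  ⋃ d ∈ D, gcdClass n d

/-- For `S ⊆ ℤ_n`, the set `qS = {qs : s ∈ S} ⊆ ℤ_N`, where each `s` is represented by an integer
in `{0, …, n - 1}`; when `N = nq` the choice of representatives is immaterial. -/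
def scaledSet (n q N : ℕ) (S : Set (ZMod n)) : Set (ZMod N) :=
  (fun s : ZMod n => ((q * s.val : ℕ) : ZMod N)) '' S

/-- The sequence `t` takes its values in `2πℤ`. -/
def InTwoPiInt (t : ℕ → ℝ) : Prop :=
  ∀ k, ∃ m : ℤ, t k = 2 * Real.pi * (m : ℝ)

end

end CirculantPGST

/-! The characters of `ZMod N` diagonalise the adjacency matrix, with real eigenvalues λ_j. At the
time 2πl the j-th phase is exp(-2πi l λ_j), so everything is about the multiples l • z of the point
z = (λ_j mod 1) of a torus. If l • z returns to 0, the graph is almost periodic, and compactness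
always provides such returns. If l • z tends to (j/2 mod 1), the phases tend to (-1)^j, the values
of the character belonging to translation by N/2, and antipodal vertices exchange state.

By Kronecker's theorem (`mem_closure_zmultiples`) the second limit occurs once every integer
relation ∑ h_j λ_j ∈ ℤ forces ∑ h_j j to be even (`even_of_relation`). Full gcd-classes contribute
integers to λ_j, and by minimality of d every class that S meets outside the multiples of d is full.
So modulo ℤ, λ_j is the sum of ζ^((s/d)j) over the s in S divisible by d, where ζ is a primitive
root of unity of order 2^r = n/d. A relation is then a polynomial divisible by 1 + X^(2^(r-1)). As r
≥ 3, such a polynomial has an even sum of coefficients at the exponents 1 mod 4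
(`coeffParity_eq_zero`). For the j-th eigenvalue that sum has the parity of j, because half of |S ∩
S_n(d)| is odd (`coeffParity_sum_X_pow`). -/

namespace CirculantPGST

/-! ### Kronecker approximation and recurrence on a torus -/

section Kronecker

open UnitAddTorus

variable {J : Type*} [Fintype J]

lemma mFourier_apply_add (n : J → ℤ) (x y : UnitAddTorus J) :
    mFourier n (x + y) = mFourier n x * mFourier n y := by
  simp only [mFourier, ContinuousMap.coe_mk, ← Finset.prod_mul_distrib, Pi.add_apply,
    fourier_apply, smul_add, AddCircle.toCircle_add, Circle.coe_mul]

lemma mFourier_apply_zero (n : J → ℤ) : mFourier n (0 : UnitAddTorus J) = 1 := by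
  simp [mFourier]

lemma mFourier_apply_nsmul (n : J → ℤ) (x : UnitAddTorus J) (l : ℕ) :
    mFourier n (l • x) = mFourier n x ^ l := by
  induction l with
  | zero => simp [mFourier_apply_zero]
  | succ l ih => rw [succ_nsmul, mFourier_apply_add, ih, pow_succ]

/-- The difference of the averages of `f` along the orbits of `w` and of `0` under translation
by `z`. -/
noncomputable def orbitAverageDiff (z w : UnitAddTorus J) (L : ℕ) (f : UnitAddTorus J → ℂ) : ℂ :=
  (L : ℂ)⁻¹ * ∑ l ∈ Finset.range L, (f (l • z + w) - f (l • z))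

/-- By linearity a single character suffices. If it is 1 at z, it is also 1 at w and every term
vanishes; otherwise the sum is geometric, bounded independently of L, and the factor 1/L kills it.
-/
lemma tendsto_orbitAverageDiff {z w : UnitAddTorus J}
    (h : ∀ n : J → ℤ, mFourier n z = 1 → mFourier n w = 1) {P : C(UnitAddTorus J, ℂ)}
    (hP : P ∈ Submodule.span ℂ (Set.range (mFourier (d := J)))) :
    Tendsto (fun L => orbitAverageDiff z w L P) atTop (𝓝 0) := by
  induction hP using Submodule.span_induction with
  | mem P hP =>
    obtain ⟨n, rfl⟩ := hP
    by_cases hz : mFourier n z = 1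
    · simp [orbitAverageDiff, mFourier_apply_add, mFourier_apply_nsmul, hz, h n hz]
    · have hb : ∀ L, ‖∑ l ∈ Finset.range L, (mFourier n (l • z + w) - mFourier n (l • z))‖ ≤
          2 / ‖mFourier n z - 1‖ * 2 := by
        intro L
        have hn : ∀ x : UnitAddTorus J, ‖mFourier n x‖ ≤ 1 := fun x =>
          ((mFourier n).norm_coe_le_norm x).trans_eq mFourier_norm
        have : ∑ l ∈ Finset.range L, (mFourier n (l • z + w) - mFourier n (l • z)) =
            (mFourier n z ^ L - 1) / (mFourier n z - 1) * (mFourier n w - 1) := by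
          rw [← geom_sum_eq hz, Finset.sum_mul]
          refine Finset.sum_congr rfl fun l _ => ?_
          rw [mFourier_apply_add, mFourier_apply_nsmul]; ring
        rw [this, norm_mul, norm_div]
        have h2 : ∀ c : ℂ, ‖c‖ ≤ 1 → ‖c - 1‖ ≤ 2 := fun c hc =>
          (norm_sub_le _ _).trans (by rw [norm_one]; linarith)
        gcongr
        · exact h2 _ (by rw [norm_pow]; exact pow_le_one₀ (norm_nonneg _) (hn z))
        · exact h2 _ (hn w)
      refine squeeze_zero_norm (a := fun L : ℕ => (L : ℝ)⁻¹ * (2 / ‖mFourier n z - 1‖ * 2)) ?_ ?_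
      · intro L
        rw [orbitAverageDiff, norm_mul, norm_inv, Complex.norm_natCast]
        gcongr
        exact hb L
      · simpa using (tendsto_inv_atTop_nhds_zero_nat (𝕜 := ℝ)).mul_const
          (2 / ‖mFourier n z - 1‖ * 2)
  | zero => simp [orbitAverageDiff]
  | add P Q _ _ hP hQ =>
    convert hP.add hQ using 2 with L
    · simp only [orbitAverageDiff, ContinuousMap.add_apply, ← mul_add, ← Finset.sum_add_distrib]
      congr 1
      exact Finset.sum_congr rfl fun _ _ => by ring
    · simp
  | smul c P _ hP =>
    convert hP.const_mul c using 2 with L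
    · simp only [orbitAverageDiff, ContinuousMap.smul_apply, smul_eq_mul, ← mul_sub,
        ← Finset.mul_sum]
      ring
    · simp

/-- **Kronecker's approximation theorem**: a point of the torus that is annihilated by every
character annihilating `z` is a limit of integer multiples of `z`. -/
theorem mem_closure_zmultiples {z w : UnitAddTorus J}
    (h : ∀ n : J → ℤ, mFourier n z = 1 → mFourier n w = 1) :
    w ∈ closure (Set.range fun l : ℤ => l • z) := by
  by_contra hw
  rw [Metric.mem_closure_iff] at hw
  push Not at hw
  obtain ⟨ε, hε, hw⟩ := hw
  set H : Set (UnitAddTorus J) := Set.range fun l : ℤ => l • z with hH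
  have hne : H.Nonempty := ⟨_, 0, rfl⟩
  -- The distance to the orbit vanishes at each l • z and is at least ε at each l • z + w, so its
  -- averages differ by at least ε. A trigonometric polynomial within ε/4 of it contradicts the
  -- vanishing limit.
  let f : C(UnitAddTorus J, ℂ) :=
    ⟨fun x => (Metric.infDist x H : ℂ),
      Complex.continuous_ofReal.comp (Metric.continuous_infDist_pt H)⟩
  have hf0 : ∀ l : ℕ, f (l • z) = 0 := fun l => by
    have : l • z ∈ H := ⟨l, by simp⟩
    simp [f, Metric.infDist_zero_of_mem this]
  have hf1 : ∀ l : ℕ, ε ≤ Metric.infDist (l • z + w) H := fun l => by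
    rw [Metric.le_infDist hne]
    rintro _ ⟨l', rfl⟩
    have := hw ((l' - l) • z) ⟨_, rfl⟩
    rw [← dist_add_left (l • z)] at this
    have hl : l • z + (l' - (l : ℤ)) • z = l' • z := by rw [sub_smul]; simp
    rwa [hl] at this
  have hmem : f ∈ (Submodule.span ℂ (Set.range (mFourier (d := J)))).topologicalClosure := by
    rw [span_mFourier_closure_eq_top]; trivial
  obtain ⟨P, hP, hfP⟩ := Metric.mem_closure_iff.1 hmem (ε / 4) (by positivity)
  have hlim := (tendsto_orbitAverageDiff h hP).eventually (Metric.ball_mem_nhds 0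
    (show 0 < ε / 4 by positivity))
  obtain ⟨L, hL, hL1⟩ := (hlim.and (eventually_ge_atTop 1)).exists
  have hLpos : (0 : ℝ) < L := by exact_mod_cast hL1
  have hsub : ‖orbitAverageDiff z w L f - orbitAverageDiff z w L P‖ ≤ ε / 2 := by
    rw [orbitAverageDiff, orbitAverageDiff, ← mul_sub, ← Finset.sum_sub_distrib, norm_mul,
      norm_inv, Complex.norm_natCast, inv_mul_le_iff₀ hLpos]
    refine (norm_sum_le_of_le _ (f := _) (n := fun _ => ε / 2) fun l _ => ?_).trans_eq (by simp)
    have hd : ∀ x, ‖f x - P x‖ ≤ ε / 4 := fun x => by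
      rw [← dist_eq_norm]
      exact (ContinuousMap.dist_apply_le_dist x).trans hfP.le
    calc _ = ‖(f (l • z + w) - P (l • z + w)) - (f (l • z) - P (l • z))‖ := by congr 1; ring
      _ ≤ ε / 4 + ε / 4 := (norm_sub_le _ _).trans (add_le_add (hd _) (hd _))
      _ = ε / 2 := by ring
  have hge : ε ≤ ‖orbitAverageDiff z w L f‖ := by
    have : orbitAverageDiff z w L f =
        (((L : ℝ)⁻¹ * ∑ l ∈ Finset.range L, Metric.infDist (l • z + w) H : ℝ) : ℂ) := by
      simp only [orbitAverageDiff, hf0, sub_zero]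
      push_cast
      rfl
    rw [this, Complex.norm_real]
    refine le_trans ?_ (le_abs_self _)
    rw [le_inv_mul_iff₀ hLpos]
    calc (L : ℝ) * ε = ∑ l ∈ Finset.range L, ε := by simp
      _ ≤ _ := Finset.sum_le_sum fun l _ => hf1 l
  have : ‖orbitAverageDiff z w L P‖ < ε / 4 := by simpa using hL
  have := norm_le_norm_add_norm_sub' (orbitAverageDiff z w L f) (orbitAverageDiff z w L P)
  linarith

/-- Recurrence of the origin under a rotation of the torus. -/
theorem exists_tendsto_nsmul_zero (z : UnitAddTorus J) :
    ∃ l : ℕ → ℕ, Tendsto l atTop atTop ∧ Tendsto (fun k => l k • z) atTop (𝓝 0) := by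
  obtain ⟨a, φ, hφ, ha⟩ := CompactSpace.tendsto_subseq (fun l : ℕ => l • z)
  -- The difference of two terms of a convergent subsequence tends to 0. The later index is taken
  -- far enough out for the difference of the multipliers to be at least k.
  have hlt : ∀ k, φ k + k ≤ φ (2 * k + φ k) := fun k => by
    have := hφ.add_le_nat (φ k) k
    have h1 := hφ.le_apply (x := 2 * k + φ k)
    have h2 := hφ.monotone (show k ≤ 2 * k + φ k by omega)
    omega
  have hto : Tendsto (fun k => 2 * k + φ k) atTop atTop :=
    tendsto_atTop_mono (fun k => by simp only [id]; omega) tendsto_id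
  refine ⟨fun k => φ (2 * k + φ k) - φ k,
    tendsto_atTop_mono (fun k => by have := hlt k; simp only [id]; omega) tendsto_id, ?_⟩
  have := (ha.comp hto).sub ha
  rw [sub_self] at this
  refine this.congr fun k => ?_
  have := hlt k
  simp only [Function.comp]
  rw [sub_eq_iff_eq_add, ← add_nsmul]
  congr 1; omega

end Kronecker

/-! ### Diagonalisation of circulant graphs by characters -/

section Spectrum

open ZMod

variable {N : ℕ} [NeZero N]

/-- The matrix of characters of `ℤ_N`. -/
noncomputable def fourierMatrix (N : ℕ) [NeZero N] : Matrix (ZMod N) (ZMod N) ℂ :=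
  Matrix.of fun a j => stdAddChar (a * j)

open Classical in
/-- The sum over `T` of the `j`-th character of `ℤ_N`. -/
noncomputable def charSum (T : Set (ZMod N)) (j : ZMod N) : ℂ :=
  ∑ s, if s ∈ T then stdAddChar (s * j) else 0

lemma charSum_eq_sum_filter (T : Set (ZMod N)) [DecidablePred (· ∈ T)] (j : ZMod N) :
    charSum T j = ∑ s with s ∈ T, stdAddChar (s * j) := by
  rw [Finset.sum_filter, charSum]
  exact Finset.sum_congr rfl fun s _ => by congr

lemma isUnit_fourierMatrix : IsUnit (fourierMatrix N) := by
  have hN : (N : ℂ) ≠ 0 := Nat.cast_ne_zero.2 (NeZero.ne N)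
  refine IsUnit.of_mul_eq_one
    (Matrix.of fun j a : ZMod N => (N : ℂ)⁻¹ * stdAddChar (-(j * a))) ?_
  ext a b
  have h : ∀ j : ZMod N, stdAddChar (a * j) * ((N : ℂ)⁻¹ * stdAddChar (-(j * b))) =
      (N : ℂ)⁻¹ * stdAddChar (j * (a - b)) := fun j => by
    rw [mul_left_comm, ← AddChar.map_add_eq_mul]; ring_nf
  simp only [fourierMatrix, Matrix.mul_apply, Matrix.of_apply, h, ← Finset.mul_sum,
    AddChar.sum_mulShift _ (isPrimitive_stdAddChar N), sub_eq_zero, Matrix.one_apply,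
    ZMod.card]
  split_ifs <;> simp [hN]

omit [NeZero N] in
lemma circulantGraph_adj_iff {T : Set (ZMod N)} (hT : IsConnectionSet T) (a b : ZMod N) :
    (SimpleGraph.circulantGraph T).Adj a b ↔ b - a ∈ T := by
  rw [SimpleGraph.circulantGraph_adj]
  constructor
  · rintro ⟨-, h | h⟩
    · simpa using hT.2 _ h
    · exact h
  · intro h
    refine ⟨fun hab => hT.1 (by simpa [hab] using h), Or.inr h⟩

lemma adj_mul_fourierMatrix {T : Set (ZMod N)} (hT : IsConnectionSet T) :
    adj (SimpleGraph.circulantGraph T) * fourierMatrix N =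
      fourierMatrix N * Matrix.diagonal (charSum T) := by
  classical
  ext a j
  rw [Matrix.mul_diagonal, Matrix.mul_apply, charSum, Finset.mul_sum,
    ← Equiv.sum_comp (Equiv.addLeft a)]
  refine Finset.sum_congr rfl fun s _ => ?_
  simp only [adj, SimpleGraph.adjMatrix_apply, circulantGraph_adj_iff hT, Equiv.coe_addLeft,
    add_sub_cancel_left, fourierMatrix, Matrix.of_apply]
  split_ifs
  · rw [one_mul, add_mul, AddChar.map_add_eq_mul]
  · simp

lemma transitionMatrix_eq {T : Set (ZMod N)} (hT : IsConnectionSet T) (t : ℝ) :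
    transitionMatrix (SimpleGraph.circulantGraph T) t =
      fourierMatrix N *
        Matrix.diagonal (fun j => Complex.exp (-(Complex.I * (t : ℂ)) * charSum T j)) *
        (fourierMatrix N)⁻¹ := by
  have hU := (Matrix.isUnit_iff_isUnit_det _).1 (isUnit_fourierMatrix (N := N))
  have hA : adj (SimpleGraph.circulantGraph T) =
      fourierMatrix N * Matrix.diagonal (charSum T) * (fourierMatrix N)⁻¹ := by
    rw [← adj_mul_fourierMatrix hT, Matrix.mul_nonsing_inv_cancel_right _ _ hU]
  rw [transitionMatrix, hA, ← Matrix.smul_mul, ← Matrix.mul_smul, ← Matrix.diagonal_smul,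
    Matrix.exp_conj _ _ isUnit_fourierMatrix, Matrix.exp_diagonal]
  congr 3
  ext j
  rw [Pi.coe_exp, Complex.exp_eq_exp_ℂ]
  simp

/-- If the phases tend to the values of a character `j ↦ χ(vj)`, then the transition matrices tend
to the matrix of the translation by `v`. -/
lemma tendsto_transitionMatrix {T : Set (ZMod N)} (hT : IsConnectionSet T) {t : ℕ → ℝ}
    (v : ZMod N)
    (h : ∀ j, Tendsto (fun k => Complex.exp (-(Complex.I * (t k : ℂ)) * charSum T j)) atTop
      (𝓝 (stdAddChar (v * j)))) :
    Tendsto (fun k => transitionMatrix (SimpleGraph.circulantGraph T) (t k)) atTop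
      (𝓝 (Matrix.of fun a b => if b = a + v then 1 else 0)) := by
  have hU := (Matrix.isUnit_iff_isUnit_det _).1 (isUnit_fourierMatrix (N := N))
  have hlim : (Matrix.of fun a b : ZMod N => if b = a + v then (1 : ℂ) else 0) =
      fourierMatrix N * Matrix.diagonal (fun j => (stdAddChar (v * j) : ℂ)) *
        (fourierMatrix N)⁻¹ := by
    rw [← Matrix.mul_nonsing_inv_cancel_right _
      (Matrix.of fun a b : ZMod N => if b = a + v then (1 : ℂ) else 0) hU]
    congr 1
    ext a j
    rw [Matrix.mul_diagonal]
    simp [Matrix.mul_apply, fourierMatrix, add_mul, AddChar.map_add_eq_mul]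
  rw [hlim]
  simp only [transitionMatrix_eq hT]
  have hd : Tendsto (fun k => Matrix.diagonal
      (fun j => Complex.exp (-(Complex.I * (t k : ℂ)) * charSum T j))) atTop
      (𝓝 (Matrix.diagonal (fun j => (stdAddChar (v * j) : ℂ)))) :=
    ((continuous_id.matrix_diagonal).tendsto _).comp (tendsto_pi_nhds.2 h)
  have hc : Continuous fun M : Matrix (ZMod N) (ZMod N) ℂ =>
      fourierMatrix N * M * (fourierMatrix N)⁻¹ := by fun_prop
  exact (hc.tendsto _).comp hd

lemma conj_charSum {T : Set (ZMod N)} (hT : IsConnectionSet T) (j : ZMod N) :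
    (starRingEnd ℂ) (charSum T j) = charSum T j := by
  classical
  rw [charSum, map_sum, ← Equiv.sum_comp (Equiv.neg (ZMod N))]
  refine Finset.sum_congr rfl fun s _ => ?_
  have : -s ∈ T ↔ s ∈ T := ⟨fun h => by simpa using hT.2 _ h, hT.2 s⟩
  simp only [Equiv.neg_apply, this]
  split_ifs
  · rw [neg_mul, AddChar.map_neg_eq_conj, Complex.conj_conj]
  · simp

lemma exists_charSum_eq_ofReal {T : Set (ZMod N)} (hT : IsConnectionSet T) :
    ∃ x : ZMod N → ℝ, ∀ j, charSum T j = (x j : ℂ) :=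
  ⟨fun j => (charSum T j).re, fun j => (Complex.conj_eq_iff_re.1 (conj_charSum hT j)).symm⟩

end Spectrum

/-! ### Integrality of character sums over gcd-classes -/

section GcdSums

variable {N : ℕ} [NeZero N]

/-- The multiples of e form a subgroup, the kernel of reduction modulo e, and a character sums over
a subgroup to its order or to 0. -/
lemma sum_dvd_val_mem_int (ψ : AddChar (ZMod N) ℂ) {e : ℕ} (he : e ∣ N) :
    ∑ x : ZMod N with e ∣ x.val, ψ x ∈ (Int.castRingHom ℂ).range := by
  classical
  let K : AddSubgroup (ZMod N) := (ZMod.castHom he (ZMod e)).toAddMonoidHom.ker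
  have hK : ∀ x : ZMod N, x ∈ K ↔ e ∣ x.val := fun x => by
    rw [← ZMod.natCast_eq_zero_iff, ← ZMod.cast_eq_val]
    exact Iff.rfl
  have h1 : ∑ x : ZMod N with e ∣ x.val, ψ x = ∑ x : K, ψ.compAddMonoidHom K.subtype x := by
    rw [Finset.sum_subtype (p := fun x => x ∈ K) _ (by simp [hK])]
    rfl
  rw [h1, AddChar.sum_eq_ite]
  split_ifs
  · exact ⟨Fintype.card K, by simp⟩
  · exact zero_mem _

/-- Möbius inversion in the form of a downward induction on e: the multiples of e split into the
class of e and classes of larger divisors. -/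
lemma sum_gcd_eq_mem_int (ψ : AddChar (ZMod N) ℂ) {e : ℕ} (he : e ∣ N) :
    ∑ x : ZMod N with x.val.gcd N = e, ψ x ∈ (Int.castRingHom ℂ).range := by
  classical
  induction hk : N - e using Nat.strong_induction_on generalizing e with
  | _ k ih =>
    subst hk
    have hdvd : ∀ x : ZMod N, e ∣ x.val ↔ x.val.gcd N ∈ N.divisors.filter (e ∣ ·) := fun x => by
      simp [Nat.gcd_dvd_right, NeZero.ne N, Nat.dvd_gcd_iff, he]
    have h1 : ∑ x : ZMod N with e ∣ x.val, ψ x =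
        ∑ e' ∈ N.divisors.filter (e ∣ ·), ∑ x : ZMod N with x.val.gcd N = e', ψ x := by
      rw [← Finset.sum_fiberwise_of_maps_to (s := Finset.univ.filter fun x : ZMod N => e ∣ x.val)
        (t := N.divisors.filter (e ∣ ·)) (g := fun x => x.val.gcd N)
        (fun x hx => (hdvd x).1 (by simpa using hx))]
      refine Finset.sum_congr rfl fun e' he' => ?_
      rw [Finset.filter_filter]
      refine Finset.sum_congr (Finset.filter_congr fun x _ => ?_) fun _ _ => rfl
      refine ⟨fun h => h.2, fun h => ⟨(hdvd x).2 (h ▸ he'), h⟩⟩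
    have hmem : e ∈ N.divisors.filter (e ∣ ·) := by simp [he, NeZero.ne N]
    rw [← Finset.add_sum_erase _ _ hmem, ← sub_eq_iff_eq_add] at h1
    rw [← h1]
    refine sub_mem (sum_dvd_val_mem_int ψ he) (sum_mem fun e' he' => ?_)
    simp only [Finset.mem_erase, Finset.mem_filter, Nat.mem_divisors] at he'
    obtain ⟨hne, ⟨he'N, -⟩, hee'⟩ := he'
    have h0 := Nat.pos_of_ne_zero (NeZero.ne N)
    have := Nat.le_of_dvd (Nat.pos_of_dvd_of_pos he'N h0) hee'
    have := Nat.le_of_dvd h0 he'N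
    exact ih (N - e') (by omega) he'N rfl

omit [NeZero N] in
lemma mem_gcdSet {E : Set ℕ} {x : ZMod N} : x ∈ gcdSet N E ↔ x.val.gcd N ∈ E := by
  simp [gcdSet, gcdClass]

open Classical in
/-- Character sums over gcd-sets are rational integers. -/
lemma sum_gcdSet_mem_int (ψ : AddChar (ZMod N) ℂ) (E : Set ℕ) :
    ∑ x : ZMod N with x ∈ gcdSet N E, ψ x ∈ (Int.castRingHom ℂ).range := by
  rw [← Finset.sum_fiberwise_of_maps_to (t := N.divisors.filter (· ∈ E))
    (g := fun x : ZMod N => x.val.gcd N)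
    (fun x hx => by
      simpa [Nat.gcd_dvd_right, NeZero.ne N, mem_gcdSet] using hx)]
  refine sum_mem fun e he => ?_
  rw [Finset.filter_filter]
  simp only [Finset.mem_filter, Nat.mem_divisors] at he
  convert sum_gcd_eq_mem_int ψ he.1.1 using 3 with x
  rw [mem_gcdSet]
  exact ⟨fun h => h.2, fun h => ⟨h ▸ he.2, h⟩⟩

lemma gcd_val_neg (x : ZMod N) : (-x).val.gcd N = x.val.gcd N := by
  rw [ZMod.neg_val]
  split_ifs with h
  · simp [h]
  · rw [Nat.gcd_comm, Nat.gcd_comm x.val, Nat.gcd_self_sub_right x.val_lt.le]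

end GcdSums

/-! ### A parity invariant of relations between roots of unity -/

section Parity

open Polynomial

/-- The sum modulo `2` of the coefficients whose index is `1` modulo `4`. -/
noncomputable def coeffParity : ℤ[X] →+ ZMod 2 :=
  (Polynomial.lsum (R := ℤ) (M := ZMod 2) fun a =>
    if a % 4 = 1 then (Int.castAddHom (ZMod 2)).toIntLinearMap else 0).toAddMonoidHom

lemma coeffParity_monomial (a : ℕ) (c : ℤ) :
    coeffParity (monomial a c) = if a % 4 = 1 then (c : ZMod 2) else 0 := by
  simp only [coeffParity, LinearMap.toAddMonoidHom_coe, Polynomial.lsum_apply]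
  rw [Polynomial.sum_monomial_index _ _ (by simp)]
  split_ifs <;> simp

lemma coeffParity_mul_X_pow (g : ℤ[X]) {c : ℕ} (hc : 4 ∣ c) :
    coeffParity (g * X ^ c) = coeffParity g := by
  induction g using Polynomial.induction_on' with
  | add p q hp hq => rw [add_mul, map_add, map_add, hp, hq]
  | monomial a z =>
    rw [Polynomial.monomial_mul_X_pow, coeffParity_monomial, coeffParity_monomial]
    congr 2
    omega

/-- f is a multiple g · (1 + X^(2^(r-1))) of the cyclotomic polynomial. Since 4 divides 2^(r-1),
both summands have the parity of g, and these cancel modulo 2. -/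
lemma coeffParity_eq_zero {r : ℕ} (hr : 3 ≤ r) {ζ : ℂ} (hζ : IsPrimitiveRoot ζ (2 ^ r)) {f : ℤ[X]}
    (hf : aeval ζ f = 0) : coeffParity f = 0 := by
  have hpos : 0 < 2 ^ r := by positivity
  have hdvd : cyclotomic (2 ^ r) ℤ ∣ f := by
    rw [cyclotomic_eq_minpoly hζ hpos]
    exact minpoly.isIntegrallyClosed_dvd (hζ.isIntegral hpos) hf
  obtain ⟨g, rfl⟩ := hdvd
  obtain ⟨s, rfl⟩ : ∃ s, r = s + 1 := ⟨r - 1, by omega⟩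
  rw [cyclotomic_prime_pow_eq_geom_sum Nat.prime_two, Finset.sum_range_succ, Finset.sum_range_one,
    pow_zero, pow_one, add_mul, one_mul, mul_comm, map_add, coeffParity_mul_X_pow]
  · exact CharTwo.add_self_eq_zero _
  · exact pow_dvd_pow 2 (show 2 ≤ s by omega)

end Parity

/-! ### The connection set and its eigenvalues modulo integers -/

section ConnectionSet

variable {n q N : ℕ} [NeZero n] [NeZero N]

lemma stdAddChar_natCast (a : ℕ) :
    ZMod.stdAddChar (N := N) a = Complex.exp (2 * Real.pi * Complex.I * a / N) := by
  simpa using ZMod.stdAddChar_coe (N := N) a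

omit [NeZero n] [NeZero N] in
lemma scaledSet_eq_zero_iff (hN : N = n * q) (hq : q ≠ 0) (m : ℕ) :
    ((q * m : ℕ) : ZMod N) = 0 ↔ (m : ZMod n) = 0 := by
  rw [ZMod.natCast_eq_zero_iff, ZMod.natCast_eq_zero_iff, hN, mul_comm n q,
    Nat.mul_dvd_mul_iff_left (Nat.pos_of_ne_zero hq)]

omit [NeZero N] in
lemma injective_scale (hN : N = n * q) (hq : q ≠ 0) :
    Function.Injective fun s : ZMod n => ((q * s.val : ℕ) : ZMod N) := by
  intro s s' h
  simp only [ZMod.natCast_eq_natCast_iff'] at h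
  have hlt : ∀ x : ZMod n, q * x.val < N := fun x => by
    rw [hN, mul_comm n q]
    exact Nat.mul_lt_mul_of_pos_left x.val_lt (Nat.pos_of_ne_zero hq)
  rw [Nat.mod_eq_of_lt (hlt s), Nat.mod_eq_of_lt (hlt s')] at h
  exact ZMod.val_injective n (Nat.eq_of_mul_eq_mul_left (Nat.pos_of_ne_zero hq) h)

lemma isConnectionSet_union (hN : N = n * q) {S : Set (ZMod n)} (hS : IsConnectionSet S)
    {D : Set ℕ} (hD : ∀ e ∈ D, e ∈ N.properDivisors) :
    IsConnectionSet (scaledSet n q N S ∪ gcdSet N D) := by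
  have hq : q ≠ 0 := by rintro rfl; exact NeZero.ne N (by simpa using hN)
  constructor
  · rintro (⟨s, hs, h⟩ | h)
    · rw [scaledSet_eq_zero_iff hN hq, ZMod.natCast_zmod_val] at h
      exact hS.1 (h ▸ hs)
    · rw [mem_gcdSet, ZMod.val_zero, Nat.gcd_zero_left] at h
      exact absurd (hD _ h) (by simp)
  · rintro x (⟨s, hs, rfl⟩ | h)
    · refine Or.inl ⟨-s, hS.2 s hs, ?_⟩
      rw [eq_neg_iff_add_eq_zero]
      dsimp only
      rw [← Nat.cast_add, ← mul_add, scaledSet_eq_zero_iff hN hq]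
      simp
    · right
      rwa [mem_gcdSet, gcd_val_neg, ← mem_gcdSet]

open Classical in
/-- The elements of `S` whose representatives are multiples of `d`. -/
noncomputable def multiplesIn (S : Set (ZMod n)) (d : ℕ) : Finset (ZMod n) :=
  {s | s ∈ S ∧ d ∣ s.val}

lemma mem_multiplesIn {S : Set (ZMod n)} {d : ℕ} {s : ZMod n} :
    s ∈ multiplesIn S d ↔ s ∈ S ∧ d ∣ s.val := by
  simp [multiplesIn]

/-- Only the multiples of d in S matter modulo ℤ: the rest of S, like `gcdSet N D`, is a union of
full gcd-classes. -/
lemma charSum_sub_mem_int (hN : N = n * q) {S : Set (ZMod n)}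
    {D : Set ℕ} (hdisj : scaledSet n q N S ∩ gcdSet N D = ∅) {d m : ℕ} (hnd : n = d * m)
    (hfull : ∀ e, e ∣ n → ¬ d ∣ e → (S ∩ gcdClass n e).Nonempty → gcdClass n e ⊆ S)
    (j : ZMod N) :
    charSum (scaledSet n q N S ∪ gcdSet N D) j -
      ∑ s ∈ multiplesIn S d, Complex.exp (2 * Real.pi * Complex.I / m) ^ (s.val / d * j.val) ∈
      (Int.castRingHom ℂ).range := by
  classical
  have hq : q ≠ 0 := by rintro rfl; exact NeZero.ne N (by simpa using hN)
  have hqC : (q : ℂ) ≠ 0 := Nat.cast_ne_zero.2 hq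
  have hnC : (n : ℂ) ≠ 0 := Nat.cast_ne_zero.2 (NeZero.ne n)
  have hdm : (d : ℂ) * m = n := by rw [hnd]; simp
  have hdC : (d : ℂ) ≠ 0 := left_ne_zero_of_mul (hdm ▸ hnC)
  have hmC : (m : ℂ) ≠ 0 := right_ne_zero_of_mul (hdm ▸ hnC)
  -- The factor q cancels in qsj/(nq), so the characters of `ZMod N` on the scaled set are
  -- characters of `ZMod n` on S.
  have hscale : ∀ s : ZMod n, ZMod.stdAddChar (((q * s.val : ℕ) : ZMod N) * j) =
      ZMod.stdAddChar (s * ((j.val : ℕ) : ZMod n)) := fun s => by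
    conv_lhs => rw [← ZMod.natCast_zmod_val j]
    conv_rhs => rw [← ZMod.natCast_zmod_val s]
    rw [← Nat.cast_mul, ← Nat.cast_mul, stdAddChar_natCast, stdAddChar_natCast]
    have hNC : (N : ℂ) = n * q := by rw [hN, Nat.cast_mul]
    congr 1
    rw [hNC]
    push_cast
    field_simp
  have hpow : ∀ s ∈ multiplesIn S d,
      Complex.exp (2 * Real.pi * Complex.I / m) ^ (s.val / d * j.val) =
      ZMod.stdAddChar (s * ((j.val : ℕ) : ZMod n)) := fun s hs => by
    conv_rhs => rw [← ZMod.natCast_zmod_val s]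
    rw [← Nat.cast_mul, stdAddChar_natCast, ← Complex.exp_nat_mul]
    congr 1
    rw [Nat.cast_mul, Nat.cast_div (mem_multiplesIn.1 hs).2 hdC, ← hdm]
    push_cast
    field_simp
  rw [Finset.sum_congr rfl hpow]
  have hsum : charSum (scaledSet n q N S ∪ gcdSet N D) j =
      ∑ s : ZMod n with s ∈ S, ZMod.stdAddChar (s * ((j.val : ℕ) : ZMod n)) +
      ∑ x : ZMod N with x ∈ gcdSet N D, ZMod.stdAddChar (x * j) := by
    rw [charSum_eq_sum_filter]
    have : (Finset.univ.filter fun x : ZMod N => x ∈ scaledSet n q N S ∪ gcdSet N D) =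
        (Finset.univ.filter fun s : ZMod n => s ∈ S).image
          (fun s : ZMod n => ((q * s.val : ℕ) : ZMod N)) ∪
        Finset.univ.filter fun x : ZMod N => x ∈ gcdSet N D := by
      ext x; simp [scaledSet]
    rw [this, Finset.sum_union, Finset.sum_image (injective_scale hN hq).injOn]
    · simp_rw [hscale]
    · rw [Finset.disjoint_left]
      intro x hx hx'
      have : x ∈ scaledSet n q N S ∩ gcdSet N D :=
        ⟨by simpa [scaledSet] using hx, by simpa using hx'⟩
      rw [hdisj] at this
      exact this
  have hsplit : (Finset.univ.filter fun s : ZMod n => s ∈ S) = multiplesIn S d ∪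
      Finset.univ.filter fun s : ZMod n =>
        s ∈ gcdSet n {e | e ∣ n ∧ ¬ d ∣ e ∧ (S ∩ gcdClass n e).Nonempty} := by
    ext s
    have hds : d ∣ s.val.gcd n ↔ d ∣ s.val := by
      rw [Nat.dvd_gcd_iff]; exact and_iff_left ⟨m, hnd⟩
    simp only [Finset.mem_filter_univ, Finset.mem_union, mem_multiplesIn, mem_gcdSet,
      Set.mem_ofPred_eq, hds]
    constructor
    · intro hs
      by_cases h : d ∣ s.val
      · exact Or.inl ⟨hs, h⟩
      · exact Or.inr ⟨Nat.gcd_dvd_right _ _, h, s, hs, rfl⟩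
    · rintro (h | ⟨h1, h2, h3⟩)
      · exact h.1
      · exact hfull _ h1 (by rwa [hds]) h3 rfl
  have hdisj' : Disjoint (multiplesIn S d) (Finset.univ.filter fun s : ZMod n =>
        s ∈ gcdSet n {e | e ∣ n ∧ ¬ d ∣ e ∧ (S ∩ gcdClass n e).Nonempty}) := by
    rw [Finset.disjoint_left]
    intro s hs hs'
    simp only [Finset.mem_filter_univ, mem_gcdSet, Set.mem_ofPred_eq] at hs'
    exact hs'.2.1 (Nat.dvd_gcd (mem_multiplesIn.1 hs).2 ⟨m, hnd⟩)
  rw [hsum, hsplit, Finset.sum_union hdisj', add_assoc, add_sub_cancel_left]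
  refine add_mem ?_ ?_
  · simpa [AddChar.mulShift_apply, mul_comm] using
      sum_gcdSet_mem_int (ZMod.stdAddChar.mulShift ((j.val : ℕ) : ZMod n)) _
  · simpa [AddChar.mulShift_apply, mul_comm] using
      sum_gcdSet_mem_int (ZMod.stdAddChar.mulShift j) D

omit [NeZero n] in
lemma mem_gcdClass_iff {d r : ℕ} (hd : d ≠ 0) (hr : r ≠ 0) (hnd : n = d * 2 ^ r) (s : ZMod n) :
    s ∈ gcdClass n d ↔ d ∣ s.val ∧ Odd (s.val / d) := by
  have key : ∀ a, (d * a).gcd n = d ↔ Odd a := fun a => by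
    rw [hnd, Nat.gcd_mul_left, Nat.mul_eq_left hd, ← Nat.coprime_iff_gcd_eq_one,
      Nat.coprime_pow_right_iff (Nat.pos_of_ne_zero hr), Nat.coprime_two_right]
  change s.val.gcd n = d ↔ _
  constructor
  · intro h
    obtain ⟨a, ha⟩ : d ∣ s.val := h ▸ Nat.gcd_dvd_left _ _
    rw [ha, key] at h
    rw [ha, Nat.mul_div_cancel_left _ (Nat.pos_of_ne_zero hd)]
    exact ⟨dvd_mul_right _ _, h⟩
  · rintro ⟨⟨a, ha⟩, h⟩
    rw [ha, Nat.mul_div_cancel_left _ (Nat.pos_of_ne_zero hd)] at h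
    rwa [ha, key]

/-- A symmetric set can split a gcd-class of `ℤ_n`, `n` a power of two, only if the quotient
order is at least `8`. -/
lemma exists_eq_mul_two_pow {k : ℕ} (hn : n = 2 ^ k) {S : Set (ZMod n)} (hS : IsConnectionSet S)
    {d : ℕ} (hdn : d ∣ n) (hne : (S ∩ gcdClass n d).Nonempty)
    (hss : S ∩ gcdClass n d ⊂ gcdClass n d) : ∃ r, 3 ≤ r ∧ n = d * 2 ^ r := by
  obtain ⟨i, hi, rfl⟩ := (Nat.dvd_prime_pow Nat.prime_two).1 (hn ▸ hdn)
  have hnr : n = 2 ^ i * 2 ^ (k - i) := by rw [← pow_add, hn]; congr 1; omega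
  refine ⟨k - i, ?_, hnr⟩
  by_contra hlt
  obtain ⟨x, hxS, hx⟩ := hne
  obtain ⟨y, hy, hyS⟩ := Set.exists_of_ssubset hss
  refine hyS ⟨?_, hy⟩
  have hd0 : 0 < 2 ^ i := by positivity
  have key : ∀ z : ZMod n, z ∈ gcdClass n (2 ^ i) →
      ∃ a < 2 ^ (k - i), z.val = 2 ^ i * a ∧ a.gcd (2 ^ (k - i)) = 1 := fun z hz => by
    change z.val.gcd n = 2 ^ i at hz
    obtain ⟨a, ha⟩ : 2 ^ i ∣ z.val := hz ▸ Nat.gcd_dvd_left _ _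
    refine ⟨a, ?_, ha, ?_⟩
    · have := z.val_lt
      rw [ha] at this
      exact Nat.lt_of_mul_lt_mul_left (this.trans_eq hnr)
    · rw [ha] at hz
      have h2 : (2 ^ i * a).gcd (2 ^ i * 2 ^ (k - i)) = 2 ^ i := hnr ▸ hz
      rwa [Nat.gcd_mul_left, Nat.mul_eq_left hd0.ne'] at h2
  obtain ⟨a, ha, hxa, hga⟩ := key x hx
  obtain ⟨b, hb, hyb, hgb⟩ := key y hy
  -- For exponent at most 2 the units modulo 2^(k-i) are only ±1, so a symmetric set containing one
  -- element of the class contains them all.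
  have hab : a = b ∨ a + b = 2 ^ (k - i) := by
    generalize k - i = r at *
    have hr : r ≤ 2 := by omega
    interval_cases r
    · left; omega
    all_goals
      norm_num at ha hb
      interval_cases a <;> interval_cases b <;> simp_all
  rcases hab with rfl | hab
  · rwa [← ZMod.val_injective n (hxa.trans hyb.symm)]
  · have : x + y = 0 := by
      rw [← ZMod.natCast_zmod_val x, ← ZMod.natCast_zmod_val y, ← Nat.cast_add, hxa, hyb,
        ← mul_add, hab, ← hnr, ZMod.natCast_self]
    rw [eq_neg_of_add_eq_zero_right this]
    exact hS.2 x hxS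

-- The exponent (s/d)j is 1 mod 4 only when both factors are odd and congruent to each other mod 4.
-- Negation exchanges the s with s/d ≡ 1 and s/d ≡ 3 mod 4, so each residue accounts for half of S ∩
-- S_n(d), an odd number. Hence odd j give 1 and even j give 0.
open Polynomial in
lemma coeffParity_sum_X_pow {S : Set (ZMod n)} (hS : IsConnectionSet S) {d r : ℕ} (hr : 3 ≤ r)
    (hnd : n = d * 2 ^ r) (hcard : (S ∩ gcdClass n d).ncard ≡ 2 [MOD 4]) (j : ℕ) :
    coeffParity (∑ s ∈ multiplesIn S d, X ^ (s.val / d * j)) = (j : ZMod 2) := by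
  classical
  have hd0 : d ≠ 0 := by rintro rfl; exact NeZero.ne n (by simpa using hnd)
  have h8 : 8 ∣ 2 ^ r := pow_dvd_pow 2 hr
  let A : ℕ → Finset (ZMod n) := fun i => (multiplesIn S d).filter fun s => s.val / d % 4 = i
  have hneg : ∀ s ∈ multiplesIn S d, s.val / d % 2 = 1 →
      -s ∈ multiplesIn S d ∧ (s.val / d + (-s).val / d) % 4 = 0 := by
    intro s hs hodd
    obtain ⟨hsS, a, ha⟩ := mem_multiplesIn.1 hs
    have hs0 : s ≠ 0 := fun h => hS.1 (h ▸ hsS)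
    have : NeZero s := ⟨hs0⟩
    have hv : (-s).val = d * (2 ^ r - a) := by
      rw [ZMod.val_neg_of_ne_zero, ha, Nat.mul_sub, ← hnd]
    have hlt : a < 2 ^ r := by
      have := s.val_lt
      rw [ha] at this
      exact Nat.lt_of_mul_lt_mul_left (this.trans_eq hnd)
    refine ⟨mem_multiplesIn.2 ⟨hS.2 s hsS, hv ▸ dvd_mul_right _ _⟩, ?_⟩
    rw [hv, ha, Nat.mul_div_cancel_left _ (Nat.pos_of_ne_zero hd0),
      Nat.mul_div_cancel_left _ (Nat.pos_of_ne_zero hd0)]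
    omega
  have h13 : (A 1).card = (A 3).card := by
    refine Finset.card_bij' (fun s _ => -s) (fun s _ => -s) ?_ ?_ (by simp) (by simp)
    all_goals
      intro s hs
      obtain ⟨hs, h⟩ := Finset.mem_filter.1 hs
      obtain ⟨h1, h2⟩ := hneg s hs (by omega)
      exact Finset.mem_filter.2 ⟨h1, by omega⟩
  have hun : (S ∩ gcdClass n d).ncard = (A 1).card + (A 3).card := by
    rw [← Finset.card_union_of_disjoint, ← Set.ncard_coe_finset]
    · congr 1
      ext s
      simp only [Set.mem_inter_iff, mem_gcdClass_iff hd0 (by omega) hnd, Finset.coe_union,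
        Set.mem_union, Finset.mem_coe, A, Finset.mem_filter, mem_multiplesIn, Nat.odd_iff]
      constructor
      · rintro ⟨h1, h2, h3⟩
        have : s.val / d % 4 = 1 ∨ s.val / d % 4 = 3 := by omega
        tauto
      · rintro (⟨⟨h1, h2⟩, h3⟩ | ⟨⟨h1, h2⟩, h3⟩) <;> exact ⟨h1, h2, by omega⟩
    · rw [Finset.disjoint_left]
      intro s hs hs'
      have := (Finset.mem_filter.1 hs).2
      have := (Finset.mem_filter.1 hs').2
      omega
  have hodd : (A 1).card % 2 = 1 := by
    have : (S ∩ gcdClass n d).ncard % 4 = 2 := hcard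
    omega
  have hpar : ∀ i j : ℕ, i % 2 = j % 2 → (i : ZMod 2) = (j : ZMod 2) := fun i j h =>
    (ZMod.natCast_eq_natCast_iff' _ _ _).2 h
  have hX : ∀ a : ℕ, coeffParity (X ^ a) = if a % 4 = 1 then 1 else 0 := fun a => by
    simpa [Polynomial.X_pow_eq_monomial] using coeffParity_monomial a 1
  rw [map_sum]
  simp only [hX]
  rw [Finset.sum_boole]
  apply hpar
  have hj : j % 4 = 0 ∨ j % 4 = 1 ∨ j % 4 = 2 ∨ j % 4 = 3 := by omega
  have hmod : ∀ a : ℕ, a * j % 4 = a % 4 * (j % 4) % 4 := fun a => Nat.mul_mod _ _ _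
  simp only [hmod]
  rcases hj with h | h | h | h
  · simp only [h]
    rw [Finset.filter_false_of_mem (fun s _ => by omega)]
    simp; omega
  · have : ∀ a : ℕ, a % 4 * 1 % 4 = 1 ↔ a % 4 = 1 := fun a => by omega
    simp only [h, this]
    change (A 1).card % 2 = _
    omega
  · simp only [h]
    rw [Finset.filter_false_of_mem (fun s _ => by omega)]
    simp; omega
  · have : ∀ a : ℕ, a % 4 * 3 % 4 = 1 ↔ a % 4 = 3 := fun a => by omega
    simp only [h, this]
    change (A 3).card % 2 = _
    omega

end ConnectionSet

/-! ### From torus dynamics to state transfer -/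

section Transfer

variable {N : ℕ} [NeZero N]

lemma exp_phase_eq (l : ℤ) (x : ℝ) :
    Complex.exp (-(Complex.I * ((2 * Real.pi * l : ℝ) : ℂ)) * x) =
      AddCircle.toCircle (-(l • (x : UnitAddCircle))) := by
  rw [← AddCircle.coe_zsmul, ← AddCircle.coe_neg, AddCircle.toCircle_apply_mk, Circle.coe_exp]
  congr 1
  rw [zsmul_eq_mul]
  push_cast
  ring

lemma mFourier_coe {J : Type*} [Fintype J] (h : J → ℤ) (x : J → ℝ) :
    UnitAddTorus.mFourier h (fun j => (x j : UnitAddCircle)) =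
      Complex.exp (2 * Real.pi * Complex.I * (∑ j, h j * x j : ℝ)) := by
  simp only [UnitAddTorus.mFourier, ContinuousMap.coe_mk, fourier_coe_apply]
  rw [← Complex.exp_sum]
  congr 1
  push_cast
  rw [Finset.mul_sum]
  exact Finset.sum_congr rfl fun j _ => by ring

omit [NeZero N] in
lemma tendsto_phase {x : ZMod N → ℝ} {l : ℕ → ℤ} {w : UnitAddTorus (ZMod N)}
    (h : Tendsto (fun k => l k • (fun j => (x j : UnitAddCircle) : UnitAddTorus (ZMod N))) atTop
      (𝓝 w)) (j : ZMod N) :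
    Tendsto (fun k => Complex.exp (-(Complex.I * ((2 * Real.pi * l k : ℝ) : ℂ)) * x j)) atTop
      (𝓝 (AddCircle.toCircle (-(w j)) : ℂ)) := by
  simp only [exp_phase_eq]
  have hc : Continuous fun u : UnitAddCircle => ((AddCircle.toCircle (-u) : Circle) : ℂ) :=
    continuous_subtype_val.comp (AddCircle.continuous_toCircle.comp continuous_neg)
  exact (hc.tendsto _).comp ((tendsto_pi_nhds.1 h) j)

/-- Every circulant graph is almost periodic along some sequence of multiples of `2π`. -/
theorem exists_almostPeriodic {T : Set (ZMod N)} (hT : IsConnectionSet T) :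
    ∃ t : ℕ → ℝ, InTwoPiInt t ∧ Tendsto t atTop atTop ∧
      AlmostPeriodic (SimpleGraph.circulantGraph T) t := by
  obtain ⟨x, hx⟩ := exists_charSum_eq_ofReal hT
  obtain ⟨l, hl, hlz⟩ := exists_tendsto_nsmul_zero
    (fun j => (x j : UnitAddCircle) : UnitAddTorus (ZMod N))
  refine ⟨fun k => 2 * Real.pi * ((l k : ℤ) : ℝ), fun k => ⟨l k, rfl⟩, ?_, 1, norm_one, ?_⟩
  · simp only [Int.cast_natCast]
    exact (tendsto_natCast_atTop_atTop.comp hl).const_mul_atTop (by positivity)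
  · have := tendsto_transitionMatrix hT (t := fun k => 2 * Real.pi * ((l k : ℤ) : ℝ)) 0
      fun j => by
        rw [hx]
        have hz : AddCircle.toCircle (-(0 : UnitAddTorus (ZMod N)) j) = 1 := by
          rw [Pi.zero_apply, neg_zero, AddCircle.toCircle_zero]
        have := tendsto_phase (x := x) (l := fun k => (l k : ℤ)) (by simpa using hlz) j
        rw [hz] at this
        simpa using this
    convert this using 2
    ext a b
    simp [Matrix.one_apply, eq_comm]

/-- Pretty good state transfer between antipodal vertices of a circulant graph, provided that
integral relations between the eigenvalues respect parity. -/
theorem exists_admitsPGST {T : Set (ZMod N)} (hT : IsConnectionSet T) (hN : Even N)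
    (hrel : ∀ h : ZMod N → ℤ,
      ∑ j, (h j : ℂ) * charSum T j ∈ (Int.castRingHom ℂ).range → Even (∑ j, h j * (j.val : ℤ))) :
    ∃ t : ℕ → ℝ, InTwoPiInt t ∧ AdmitsPGST (SimpleGraph.circulantGraph T) t := by
  obtain ⟨x, hx⟩ := exists_charSum_eq_ofReal hT
  -- The target phases exp(-πij) = (-1)^j are the values at j of the character attached to the
  -- antipode N/2.
  let w : ZMod N → ℝ := fun j => j.val / 2
  have hw : (fun j => (w j : UnitAddCircle) : UnitAddTorus (ZMod N)) ∈
      closure (Set.range fun l : ℤ =>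
        l • (fun j => (x j : UnitAddCircle) : UnitAddTorus (ZMod N))) := by
    refine mem_closure_zmultiples fun h hz => ?_
    rw [mFourier_coe, Complex.exp_eq_one_iff] at hz ⊢
    obtain ⟨c, hc⟩ := hz
    rw [mul_comm (c : ℂ), mul_right_inj' Complex.two_pi_I_ne_zero] at hc
    obtain ⟨e, he⟩ := hrel h ⟨c, by simp only [hx]; push_cast at hc; exact hc.symm⟩
    refine ⟨e, ?_⟩
    rw [mul_comm (e : ℂ)]
    congr 1
    have h2 : ((∑ j, h j * (j.val : ℤ) : ℤ) : ℂ) = e + e := by rw [he]; push_cast; rfl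
    push_cast at h2
    simp only [w]
    push_cast
    simp only [← mul_div_assoc, ← Finset.sum_div]
    rw [h2]
    ring
  obtain ⟨u, hu, hlim⟩ := mem_closure_iff_seq_limit.1 hw
  choose l hl using hu
  obtain ⟨c, hc⟩ := hN
  have hc0 : c ≠ 0 := by rintro rfl; exact NeZero.ne N hc
  have hne : (c : ZMod N) ≠ 0 := fun h => by
    have := Nat.le_of_dvd (Nat.pos_of_ne_zero hc0) ((ZMod.natCast_eq_zero_iff _ _).1 h)
    omega
  have hneg : -(c : ZMod N) = c := by
    rw [neg_eq_iff_add_eq_zero, ← Nat.cast_add, ← hc, ZMod.natCast_self]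
  have hM := tendsto_transitionMatrix hT (t := fun k => 2 * Real.pi * (l k : ℝ)) (-(c : ZMod N))
    fun j => by
      rw [hx]
      convert tendsto_phase (x := x) (l := l) (by simpa only [hl] using hlim) j using 2
      have hcC : (c : ℂ) ≠ 0 := Nat.cast_ne_zero.2 hc0
      conv_lhs => rw [← ZMod.natCast_zmod_val j]
      rw [neg_mul, AddChar.map_neg_eq_conj, ← Nat.cast_mul, stdAddChar_natCast,
        AddCircle.toCircle_neg, Circle.coe_inv_eq_conj, AddCircle.toCircle_apply_mk,
        Circle.coe_exp]
      congr 2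
      have hNC : (N : ℂ) = c + c := by rw [hc, Nat.cast_add]
      rw [hNC, ← two_mul]
      simp only [w]
      push_cast
      field_simp
  refine ⟨fun k => 2 * Real.pi * (l k : ℝ), fun k => ⟨l k, rfl⟩, 0, c, hne.symm, 1, norm_one, ?_⟩
  have hcont : Continuous fun M : Matrix (ZMod N) (ZMod N) ℂ => M.mulVec (Pi.single 0 1) := by
    fun_prop
  rw [hneg] at hM
  have hv : (Pi.single (c : ZMod N) 1 : ZMod N → ℂ) =
      (Matrix.of fun a b : ZMod N => if b = a + c then (1 : ℂ) else 0).mulVec (Pi.single 0 1) := by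
    ext a
    have : (0 : ZMod N) = a + c ↔ a = c := by
      rw [eq_comm, ← eq_neg_iff_add_eq_zero, hneg]
    simp [Pi.single_apply, this]
  rw [one_smul, hv]
  exact (hcont.tendsto _).comp hM

end Transfer

-- The relation becomes an integer polynomial vanishing at ζ, and the parity invariant of that
-- polynomial is ∑ h_j j mod 2.
open Polynomial in
lemma even_of_relation {n q N : ℕ} [NeZero n] [NeZero N] (hN : N = n * q) {S : Set (ZMod n)}
    (hS : IsConnectionSet S) {D : Set ℕ} (hdisj : scaledSet n q N S ∩ gcdSet N D = ∅) {d r : ℕ}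
    (hr : 3 ≤ r) (hnd : n = d * 2 ^ r)
    (hfull : ∀ e, e ∣ n → ¬ d ∣ e → (S ∩ gcdClass n e).Nonempty → gcdClass n e ⊆ S)
    (hcard : (S ∩ gcdClass n d).ncard ≡ 2 [MOD 4]) (h : ZMod N → ℤ)
    (hh : ∑ j, (h j : ℂ) * charSum (scaledSet n q N S ∪ gcdSet N D) j ∈
      (Int.castRingHom ℂ).range) :
    Even (∑ j, h j * (j.val : ℤ)) := by
  set ζ : ℂ := Complex.exp (2 * Real.pi * Complex.I / (2 ^ r : ℕ)) with hζ
  have hprim : IsPrimitiveRoot ζ (2 ^ r) := Complex.isPrimitiveRoot_exp _ (by positivity)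
  have hmem : ∑ j : ZMod N, (h j : ℂ) * ∑ s ∈ multiplesIn S d, ζ ^ (s.val / d * j.val) ∈
      (Int.castRingHom ℂ).range := by
    have h1 : ∑ j : ZMod N, (h j : ℂ) * (charSum (scaledSet n q N S ∪ gcdSet N D) j -
        ∑ s ∈ multiplesIn S d, ζ ^ (s.val / d * j.val)) ∈ (Int.castRingHom ℂ).range :=
      sum_mem fun j _ => mul_mem ⟨h j, rfl⟩ (charSum_sub_mem_int hN hdisj hnd hfull j)
    simpa [mul_sub] using sub_mem hh h1
  obtain ⟨c, hc⟩ := hmem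
  have hf : aeval ζ (∑ j : ZMod N, h j • ∑ s ∈ multiplesIn S d, X ^ (s.val / d * j.val) -
      C c : ℤ[X]) = 0 := by
    simp only [map_sub, map_sum, zsmul_eq_mul, map_mul, map_intCast, map_pow, aeval_X,
      aeval_C]
    rw [← hc, sub_eq_zero]
    rfl
  have := coeffParity_eq_zero hr hprim hf
  -- The integer c sits at exponent 0, which the invariant ignores.
  rw [map_sub, map_sum, ← monomial_zero_left, coeffParity_monomial, if_neg (by norm_num),
    sub_zero] at this
  simp only [map_zsmul, coeffParity_sum_X_pow hS hr hnd hcard] at this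
  rw [← ZMod.intCast_eq_zero_iff_even]
  push_cast
  simpa [zsmul_eq_mul] using this

end CirculantPGST

theorem corollary2p5 (k n q N : ℕ) [NeZero n] [NeZero N]
    (hn : n = 2 ^ k) (hq : Odd q) (hN : N = n * q)
    (S : Set (ZMod n)) (hS : CirculantPGST.IsConnectionSet S)
    (hnonint : ¬ CirculantPGST.IsIntegral (SimpleGraph.circulantGraph S))
    (d : ℕ)
    (hd : IsLeast {e : ℕ | e ∣ n ∧ (S ∩ CirculantPGST.gcdClass n e).Nonempty ∧
      S ∩ CirculantPGST.gcdClass n e ⊂ CirculantPGST.gcdClass n e} d)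
    (D : Set ℕ) (hD : ∀ e ∈ D, e ∈ N.properDivisors)
    (hdisj : CirculantPGST.scaledSet n q N S ∩ CirculantPGST.gcdSet N D = ∅) :
    ((S ∩ CirculantPGST.gcdClass n d).ncard ≡ 2 [MOD 4] →
      ∃ t : ℕ → ℝ, CirculantPGST.InTwoPiInt t ∧
        CirculantPGST.AdmitsPGST
          (SimpleGraph.circulantGraph
            (CirculantPGST.scaledSet n q N S ∪ CirculantPGST.gcdSet N D)) t) ∧
    ((S ∩ CirculantPGST.gcdClass n d).ncard ≡ 0 [MOD 4] →
      ∃ t : ℕ → ℝ, CirculantPGST.InTwoPiInt t ∧ Tendsto t atTop atTop ∧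
        CirculantPGST.AlmostPeriodic
          (SimpleGraph.circulantGraph
            (CirculantPGST.scaledSet n q N S ∪ CirculantPGST.gcdSet N D)) t) := by
  have hT := CirculantPGST.isConnectionSet_union hN hS hD
  refine ⟨fun hcard => ?_, fun _ => CirculantPGST.exists_almostPeriodic hT⟩
  obtain ⟨⟨hdn, hne, hss⟩, hleast⟩ := hd
  obtain ⟨r, hr, hnd⟩ := CirculantPGST.exists_eq_mul_two_pow hn hS hdn hne hss
  have hfull : ∀ e, e ∣ n → ¬ d ∣ e → (S ∩ CirculantPGST.gcdClass n e).Nonempty →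
      CirculantPGST.gcdClass n e ⊆ S := by
    intro e he hde hnon
    by_contra hsub
    have hle : d ≤ e := hleast ⟨he, hnon, Set.inter_subset_right,
      fun h => hsub fun x hx => (h hx).1⟩
    -- The divisors of a power of two form a chain under divisibility, so d ≤ e already gives d ∣ e.
    obtain ⟨i, -, rfl⟩ := (Nat.dvd_prime_pow Nat.prime_two).1 (hn ▸ hdn)
    obtain ⟨i', -, rfl⟩ := (Nat.dvd_prime_pow Nat.prime_two).1 (hn ▸ he)
    exact hde (pow_dvd_pow 2 ((Nat.pow_le_pow_iff_right (by norm_num)).1 hle))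
  have hev : Even N := by
    rw [hN, hnd]
    exact ((Nat.even_pow.2 ⟨even_two, by omega⟩).mul_left d).mul_right q
  exact CirculantPGST.exists_admitsPGST hT hev
    (CirculantPGST.even_of_relation hN hS hdisj hr hnd hfull hcard)
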